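/- **Corollary 3.2 (Central Stirling numbers).** Let $S(n,k)$ denote the Stirling numbers of the second kind, $\nu=\nu_2$ the $2$-adic valuation, $\sigma(n)$ the sum of the base two digits of $n$, and $[n]$ the set of powers of two occurring in the base two expansion of $n$. When $0\le k\le n$ and $S(n,k)\neq 0$, the almost minimum zero estimate is $$\nu(S(n,k))\ \ge\ \sigma(k)-\sigma(n)+\#([n]\cap[n-k]).$$ Say that $S(n,k)$ is a *minimum zero case* (MZC) if $\nu(S(n,k))=\sigma(k)-\sigma(n)$, and an *almost minimum zero case* (AMZC) if $\nu(S(n,k))=\sigma(k)-\sigma(n)+\#([n]\cap[n-k])$ and $S(n,k)$ is not a MZC. A non-negative integer is *Fibbinary* if its binary expansion contains no two consecutive ones. Let $P(k)$ be the number of pairs of consecutive ones in the binary expansion of $k$, i.e. the number of $i\ge 0$ such that the binary digits of $k$ at the places $2^i$ and $2^{i+1}$ are both $1$. Then for every integer $k\ge 0$: (a) The almost minimum zero estimate for $S(2k,k)$ is $\nu(S(2k,k))\ge P(k)$; that is, $\sigma(k)-\sigma(2k)+\#([2k]\cap[k])=P(k)$, and $\nu(S(2k,k))\ge P(k)$ holds.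 (b) The following are equivalent: $\nu(S(2k,k))=1$; $S(2k,k)$ is an AMZC; $k=3+8k'$ for some Fibbinary integer $k'\ge 0$. -/

import Mathlib

namespace CentralStirling

/-- `σ(n)`: the sum of the base two digits of `n`. -/
def sigma (n : ℕ) : ℕ := (Nat.digits 2 n).sum

/-- `[n]`: the set of powers of two occurring in the base two expansion of `n`. -/
def twoPowers (n : ℕ) : Finset ℕ := n.bitIndices.toFinset.image (fun i => 2 ^ i)

/-- `ν(S(n,k))`: the 2-adic valuation of the Stirling number of the second kind
(meaningful when `S(n,k) ≠ 0`). -/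
def nuS (n k : ℕ) : ℕ := padicValNat 2 (Nat.stirlingSecond n k)

/-- The minimum zero estimate `σ(k) - σ(n)`, a possibly negative integer. -/
def minZeroEst (n k : ℕ) : ℤ := (sigma k : ℤ) - sigma n

/-- The almost minimum zero estimate `σ(k) - σ(n) + #([n] ∩ [n-k])`, for `k ≤ n`. -/
def almostMinZeroEst (n k : ℕ) : ℤ :=
  (sigma k : ℤ) - sigma n + (twoPowers n ∩ twoPowers (n - k)).card

/-- `S(n,k)` is a minimum zero case (MZC): the minimum zero estimate is sharp.
The clause `S(n,k) ≠ 0` forces `k ≤ n`, and says that the valuation is finite. -/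
def IsMZC (n k : ℕ) : Prop :=
  Nat.stirlingSecond n k ≠ 0 ∧ (nuS n k : ℤ) = minZeroEst n k

/-- `S(n,k)` is an almost minimum zero case (AMZC): the almost minimum zero estimate is sharp,
but `S(n,k)` is not a minimum zero case. -/
def IsAMZC (n k : ℕ) : Prop :=
  Nat.stirlingSecond n k ≠ 0 ∧ (nuS n k : ℤ) = almostMinZeroEst n k ∧ ¬ IsMZC n k

/-- The number of pairs of consecutive ones in the base two expansion of `k`: the number of
places `i` such that the digits of `k` at `i` and `i + 1` are both one. Pairs may overlap.
All places of nonzero digits of `k` are smaller than `k`. -/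
def consecutiveOnePairs (k : ℕ) : ℕ :=
  ((Finset.range k).filter (fun i => k.testBit i = true ∧ k.testBit (i + 1) = true)).card

/-- `k` is Fibbinary: its base two expansion has no two consecutive ones. -/
def Fibbinary (k : ℕ) : Prop :=
  ∀ i : ℕ, ¬ (k.testBit i = true ∧ k.testBit (i + 1) = true)

end CentralStirling

/-!
Let `P(k)` be the number of places at which both `2 * k` and `k` have the digit one; this is the
number of pairs of consecutive ones of `k`, and also `#([2k] ∩ [k])`. Since `σ(2k) = σ(k)`, the almost
minimum zero estimate for `S(2k, k)` is `P(k)`, and the minimum zero estimate is zero.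

The series `(exp (2 * y) - 1) / 2` has the compositional inverse `X * w`, where
`w = ∑ (-2) ^ j / (j + 1) * X ^ j` has 2-adically integral coefficients. Lagrange inversion gives
`S(2k, k) = (2k - 1)‼ * c`, where `c` is the coefficient of `X ^ k` in `w ^ (-(2k + 1)) * (1 + 2X)⁻¹`
(`two_pow_mul_factorial_mul_stirlingSecond`; it is proved through the recurrence of the Stirling
numbers). Write `w = (1 - X) + T` and expand in powers of `T`: then `c` is the sum over `i` and `x` of
`± C(2k + i, i) * C(3k + i - x, k - x)` times the coefficient of `X ^ x` in `T ^ i * (1 + 2X)⁻¹`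
(`coeff_invLogSeries_pow_mul`).

The product of binomial coefficients is divisible by `2` to the number of common ones of `2k` and
`k - x`, by Kummer's theorem. Replacing `k` by `k - x` loses at most `⌈x / 4⌉` common ones
(`commonOnes_even_add_le`), and none for `x = 1` (`commonOnes_two_mul_succ_le`), while the coefficients of `T ^ i * (1 + 2X)⁻¹ - (-2 * X ^ 3) ^ i` are
divisible by `2 ^ ⌈(x + 2) / 3⌉` (`slopeThird_logTail_pow_mul_sub`), which more than makes up for the
loss. Treating the powers of `-2 * X ^ 3` separately leaves two summands
(`two_pow_succ_dvd_coeff_sub`): for `k ≥ 3`,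
`c ≡ C(3k, k) + 2 * (2k + 1) * C(3k - 2, k - 3)` modulo `2 ^ (P(k) + 1)`.

The rest is the counting of carries. If `P(k) = 0`, the first summand is odd. If `P(k) > 0`, the
first summand vanishes modulo `2 ^ (P(k) + 1)`, since the carry at the top of a run of ones
propagates; the second vanishes too, unless `k = 3 + 8 * q` with `q` Fibbinary, and then `P(k) = 1`
and `C(3k - 2, k - 3)` is odd.
-/

namespace CentralStirling

open PowerSeries

/-! ### Digit sums, common ones and binomial coefficients -/

/-- The number of binary places at which both `a` and `x` have the digit one. -/
def commonOnes (a x : ℕ) : ℕ := sigma (a &&& x)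

lemma sigma_zero : sigma 0 = 0 := by simp [sigma]

lemma sigma_two_mul (n : ℕ) : sigma (2 * n) = sigma n := by
  rcases Nat.eq_zero_or_pos n with rfl | hn
  · rfl
  · simp [sigma, Nat.digits_def' (b := 2) (by norm_num) (show 0 < 2 * n by omega)]

lemma sigma_two_mul_add_one (n : ℕ) : sigma (2 * n + 1) = sigma n + 1 := by
  rw [sigma, Nat.digits_def' (b := 2) (by norm_num) (show 0 < 2 * n + 1 by omega),
    show (2 * n + 1) % 2 = 1 by omega, show (2 * n + 1) / 2 = n by omega, sigma,
    List.sum_cons, add_comm]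

lemma sigma_succ_le (n : ℕ) : sigma (n + 1) ≤ sigma n + 1 := by
  induction n using Nat.strong_induction_on with
  | _ n ih =>
    obtain ⟨m, rfl | rfl⟩ := Nat.even_or_odd' n
    · rw [sigma_two_mul_add_one, sigma_two_mul]
    · have := ih m (by omega)
      rw [show 2 * m + 1 + 1 = 2 * (m + 1) by ring, sigma_two_mul, sigma_two_mul_add_one]
      omega

lemma commonOnes_zero_left (x : ℕ) : commonOnes 0 x = 0 := by simp [commonOnes, sigma_zero]

lemma commonOnes_even_even (a x : ℕ) : commonOnes (2 * a) (2 * x) = commonOnes a x := by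
  have := Nat.land_bit false a false x
  simp only [Nat.bit_false, Bool.and_self] at this
  rw [commonOnes, this, sigma_two_mul, commonOnes]

lemma commonOnes_even_odd (a x : ℕ) : commonOnes (2 * a) (2 * x + 1) = commonOnes a x := by
  have := Nat.land_bit false a true x
  simp only [Nat.bit_false, Nat.bit_true, Bool.and_true] at this
  rw [commonOnes, this, sigma_two_mul, commonOnes]

lemma commonOnes_odd_even (a x : ℕ) : commonOnes (2 * a + 1) (2 * x) = commonOnes a x := by
  have := Nat.land_bit true a false x
  simp only [Nat.bit_false, Nat.bit_true, Bool.and_false] at this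
  rw [commonOnes, this, sigma_two_mul, commonOnes]

lemma commonOnes_odd_odd (a x : ℕ) :
    commonOnes (2 * a + 1) (2 * x + 1) = commonOnes a x + 1 := by
  have := Nat.land_bit true a true x
  simp only [Nat.bit_true, Bool.and_self] at this
  rw [commonOnes, this, sigma_two_mul_add_one, commonOnes]

lemma sigma_add_add_commonOnes_le (a x : ℕ) :
    sigma (a + x) + commonOnes a x ≤ sigma a + sigma x := by
  induction a using Nat.strong_induction_on generalizing x with
  | _ a ih =>
    rcases Nat.eq_zero_or_pos a with rfl | ha
    · simp [commonOnes_zero_left, sigma_zero]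
    obtain ⟨b, rfl | rfl⟩ := Nat.even_or_odd' a <;> obtain ⟨y, rfl | rfl⟩ := Nat.even_or_odd' x <;>
      have := ih b (by omega) y
    · rw [← mul_add, sigma_two_mul, sigma_two_mul, sigma_two_mul, commonOnes_even_even]
      exact this
    · rw [← add_assoc, ← mul_add, sigma_two_mul_add_one, sigma_two_mul, sigma_two_mul_add_one,
        commonOnes_even_odd]
      omega
    · rw [show 2 * b + 1 + 2 * y = 2 * (b + y) + 1 by ring, sigma_two_mul_add_one, sigma_two_mul,
        sigma_two_mul_add_one, commonOnes_odd_even]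
      omega
    · rw [show 2 * b + 1 + (2 * y + 1) = 2 * (b + y + 1) by ring, sigma_two_mul,
        sigma_two_mul_add_one, sigma_two_mul_add_one, commonOnes_odd_odd]
      have := sigma_succ_le (b + y)
      omega

/-- Kummer's theorem at the prime two, in terms of digit sums. -/
lemma padicValNat_choose_add_sigma (a x : ℕ) :
    padicValNat 2 ((a + x).choose x) + sigma (a + x) = sigma a + sigma x := by
  have := sub_one_mul_padicValNat_choose_eq_sub_sum_digits' (p := 2) (k := x) (n := a)
  have h := sigma_add_add_commonOnes_le a x
  change (2 - 1) * _ = sigma x + sigma a - sigma (a + x) at this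
  omega

/-- Each place where both summands have the digit one produces a carry. -/
lemma two_pow_commonOnes_dvd_choose (a x : ℕ) : 2 ^ commonOnes a x ∣ (a + x).choose x := by
  have h := padicValNat_choose_add_sigma a x
  have h' := sigma_add_add_commonOnes_le a x
  exact (pow_dvd_pow 2 (by omega)).trans pow_padicValNat_dvd

/-! ### Lowering one argument loses few common ones -/

lemma commonOnes_add_one_le (a x : ℕ) : commonOnes a (x + 1) ≤ commonOnes a x + 1 := by
  induction a using Nat.strong_induction_on generalizing x with
  | _ a ih =>
    rcases Nat.eq_zero_or_pos a with rfl | ha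
    · simp [commonOnes_zero_left]
    obtain ⟨b, rfl | rfl⟩ := Nat.even_or_odd' a <;> obtain ⟨y, rfl | rfl⟩ := Nat.even_or_odd' x <;>
      have := ih b (by omega) y
    · rw [commonOnes_even_even, commonOnes_even_odd]
      omega
    · rw [show 2 * y + 1 + 1 = 2 * (y + 1) by ring, commonOnes_even_even, commonOnes_even_odd]
      omega
    · rw [commonOnes_odd_even, commonOnes_odd_odd]
    · rw [show 2 * y + 1 + 1 = 2 * (y + 1) by ring, commonOnes_odd_even, commonOnes_odd_odd]
      omega

lemma commonOnes_add_two_mul_le {a x y m : ℕ}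
    (h : ∀ b z, commonOnes b (z + y) ≤ commonOnes b z + m) :
    commonOnes a (x + 2 * y) ≤ commonOnes a x + m := by
  obtain ⟨b, rfl | rfl⟩ := Nat.even_or_odd' a <;> obtain ⟨z, rfl | rfl⟩ := Nat.even_or_odd' x <;>
    have := h b z
  · rw [← mul_add, commonOnes_even_even, commonOnes_even_even]
    omega
  · rw [show 2 * z + 1 + 2 * y = 2 * (z + y) + 1 by ring, commonOnes_even_odd, commonOnes_even_odd]
    omega
  · rw [← mul_add, commonOnes_odd_even, commonOnes_odd_even]
    omega
  · rw [show 2 * z + 1 + 2 * y = 2 * (z + y) + 1 by ring, commonOnes_odd_odd, commonOnes_odd_odd]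
    omega

lemma commonOnes_add_two_le (a x : ℕ) : commonOnes a (x + 2) ≤ commonOnes a x + 1 :=
  commonOnes_add_two_mul_le (y := 1) commonOnes_add_one_le

lemma commonOnes_add_four_le (a x : ℕ) : commonOnes a (x + 4) ≤ commonOnes a x + 1 :=
  commonOnes_add_two_mul_le (y := 2) commonOnes_add_two_le

lemma commonOnes_add_eight_le (a x : ℕ) : commonOnes a (x + 8) ≤ commonOnes a x + 1 :=
  commonOnes_add_two_mul_le (y := 4) commonOnes_add_four_le

lemma commonOnes_even_add_three_le (a x : ℕ) :
    commonOnes (2 * a) (x + 3) ≤ commonOnes (2 * a) x + 1 := by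
  obtain ⟨z, rfl | rfl⟩ := Nat.even_or_odd' x
  · rw [show 2 * z + 3 = 2 * (z + 1) + 1 by ring, commonOnes_even_odd, commonOnes_even_even]
    exact commonOnes_add_one_le a z
  · rw [show 2 * z + 1 + 3 = 2 * (z + 2) by ring, commonOnes_even_odd, commonOnes_even_even]
    exact commonOnes_add_two_le a z

lemma commonOnes_even_add_le (a x y : ℕ) :
    commonOnes (2 * a) (x + y) ≤ commonOnes (2 * a) x + (y + 3) / 4 := by
  induction y using Nat.strong_induction_on with
  | _ y ih =>
    rcases (by omega : y = 0 ∨ y = 1 ∨ y = 2 ∨ y = 3 ∨ 4 ≤ y) with rfl | rfl | rfl | rfl | hy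
    · simp
    · exact commonOnes_add_one_le _ _
    · exact commonOnes_add_two_le _ _
    · exact commonOnes_even_add_three_le _ _
    · obtain ⟨z, rfl⟩ := Nat.exists_eq_add_of_le' hy
      have h1 := ih z (by omega)
      have h2 := commonOnes_add_four_le (2 * a) (x + z)
      rw [← add_assoc]
      omega

/-- Passing from `x + 1` to `x` clears one place and fills all lower ones; since `2 * (x + 1)` has
the digit zero at the cleared place, no common one is lost. -/
lemma commonOnes_two_mul_succ_le (x : ℕ) :
    commonOnes (2 * (x + 1)) (x + 1) ≤ commonOnes (2 * (x + 1)) x := by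
  induction x using Nat.strong_induction_on with
  | _ x ih =>
    obtain ⟨z, rfl | rfl⟩ := Nat.even_or_odd' x
    · rw [commonOnes_even_odd, commonOnes_even_even]
    · have := ih z (by omega)
      rw [show 2 * z + 1 + 1 = 2 * (z + 1) by ring, commonOnes_even_even, commonOnes_even_odd]
      exact this

/-! ### Overlapping pairs of consecutive ones -/

lemma commonOnes_two_mul_self_even (k : ℕ) :
    commonOnes (2 * (2 * k)) (2 * k) = commonOnes (2 * k) k := commonOnes_even_even _ _

lemma commonOnes_two_mul_self_four_mul_add_one (k : ℕ) :
    commonOnes (2 * (4 * k + 1)) (4 * k + 1) = commonOnes (2 * k) k := by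
  rw [show 4 * k + 1 = 2 * (2 * k) + 1 by ring, commonOnes_even_odd, commonOnes_odd_even]

lemma commonOnes_two_mul_self_four_mul_add_three (k : ℕ) :
    commonOnes (2 * (4 * k + 3)) (4 * k + 3) =
      commonOnes (2 * (2 * k + 1)) (2 * k + 1) + 1 := by
  rw [show 4 * k + 3 = 2 * (2 * k + 1) + 1 by ring, commonOnes_even_odd, commonOnes_even_odd,
    commonOnes_odd_odd]

lemma sigma_three_mul_of_commonOnes_eq_zero {k : ℕ} (h : commonOnes (2 * k) k = 0) :
    sigma (3 * k) = 2 * sigma k := by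
  induction k using Nat.strong_induction_on with
  | _ k ih =>
    obtain ⟨l, rfl | rfl⟩ := Nat.even_or_odd' k
    · rcases Nat.eq_zero_or_pos l with rfl | hl
      · simp [sigma_zero]
      rw [commonOnes_two_mul_self_even] at h
      rw [show 3 * (2 * l) = 2 * (3 * l) by ring, sigma_two_mul, sigma_two_mul]
      exact ih l (by omega) h
    · obtain ⟨m, rfl | rfl⟩ := Nat.even_or_odd' l
      · rw [show 2 * (2 * m) + 1 = 4 * m + 1 by ring,
          commonOnes_two_mul_self_four_mul_add_one] at h
        have := ih m (by omega) h
        rw [show 3 * (2 * (2 * m) + 1) = 2 * (2 * (3 * m) + 1) + 1 by ring]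
        simp only [sigma_two_mul_add_one, sigma_two_mul]
        omega
      · rw [show 2 * (2 * m + 1) + 1 = 4 * m + 3 by ring,
          commonOnes_two_mul_self_four_mul_add_three] at h
        omega

/-- With a carry coming in at the lowest place, the addition `2 * l + l` of an odd `l` has at least
two carries more than places with two ones: the carry propagates into the lowest run of ones of
`l` and out of its top. -/
lemma sigma_three_mul_add_one_add_le_of_odd {l : ℕ} (hl : Odd l) :
    sigma (3 * l + 1) + commonOnes (2 * l) l + 1 ≤ 2 * sigma l := by
  induction l using Nat.strong_induction_on with
  | _ l ih =>
    obtain ⟨m, rfl⟩ := hl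
    have h3 := sigma_succ_le (3 * m + 1)
    rw [show 3 * (2 * m + 1) + 1 = 2 * (3 * m + 1 + 1) by ring, sigma_two_mul,
      sigma_two_mul_add_one]
    obtain ⟨q, rfl | rfl⟩ := Nat.even_or_odd' m
    · have h1 := sigma_succ_le (3 * q)
      have h2 := sigma_add_add_commonOnes_le (2 * q) q
      rw [show 2 * (2 * q) + 1 = 4 * q + 1 by ring, commonOnes_two_mul_self_four_mul_add_one,
        show 3 * (2 * q) + 1 + 1 = 2 * (3 * q + 1) by ring]
      rw [show 2 * q + q = 3 * q by ring] at h2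
      simp only [sigma_two_mul] at h2 ⊢
      omega
    · have := ih (2 * q + 1) (by omega) ⟨q, rfl⟩
      rw [show 2 * (2 * q + 1) + 1 = 4 * q + 3 by ring,
        commonOnes_two_mul_self_four_mul_add_three]
      omega

/-- If `k` has two consecutive ones, then the carry at the top of a run of ones propagates one place
further, so that the addition `2 * k + k` has more carries than places with two ones. -/
lemma sigma_three_mul_add_lt {k : ℕ} (h : 1 ≤ commonOnes (2 * k) k) :
    sigma (3 * k) + commonOnes (2 * k) k + 1 ≤ 2 * sigma k := by
  induction k using Nat.strong_induction_on with
  | _ k ih =>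
    obtain ⟨l, rfl | rfl⟩ := Nat.even_or_odd' k
    · rcases Nat.eq_zero_or_pos l with rfl | hl
      · simp [commonOnes_zero_left] at h
      rw [commonOnes_two_mul_self_even] at h
      rw [show 3 * (2 * l) = 2 * (3 * l) by ring, commonOnes_two_mul_self_even, sigma_two_mul,
        sigma_two_mul]
      exact ih l (by omega) h
    · obtain ⟨m, rfl | rfl⟩ := Nat.even_or_odd' l
      · have h4 : 2 * (2 * m) + 1 = 4 * m + 1 := by ring
        rw [h4, commonOnes_two_mul_self_four_mul_add_one] at h
        have := ih m (by omega) h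
        rw [show 3 * (2 * (2 * m) + 1) = 2 * (2 * (3 * m) + 1) + 1 by ring]
        simp only [sigma_two_mul_add_one, sigma_two_mul]
        rw [h4, commonOnes_two_mul_self_four_mul_add_one]
        omega
      · have := sigma_three_mul_add_one_add_le_of_odd (l := 2 * m + 1) ⟨m, rfl⟩
        rw [show 3 * (2 * (2 * m + 1) + 1) = 2 * (3 * (2 * m + 1) + 1) + 1 by ring,
          sigma_two_mul_add_one, sigma_two_mul_add_one]
        rw [show 2 * (2 * m + 1) + 1 = 4 * m + 3 by ring,
          commonOnes_two_mul_self_four_mul_add_three]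
        omega

/-! ### Valuations of the two binomial coefficients that survive -/

lemma odd_choose_three_mul {k : ℕ} (h : commonOnes (2 * k) k = 0) :
    ¬ 2 ∣ (3 * k).choose k := by
  have h1 := padicValNat_choose_add_sigma (2 * k) k
  have h2 := sigma_three_mul_of_commonOnes_eq_zero h
  rw [show 2 * k + k = 3 * k by ring, sigma_two_mul] at h1
  have h3 : padicValNat 2 ((3 * k).choose k) = 0 := by omega
  rcases padicValNat.eq_zero_iff.mp h3 with h | h | h
  · omega
  · exact absurd h (Nat.choose_pos (by omega)).ne'
  · exact h

lemma two_pow_succ_dvd_choose_three_mul {k : ℕ} (h : 1 ≤ commonOnes (2 * k) k) :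
    2 ^ (commonOnes (2 * k) k + 1) ∣ (3 * k).choose k := by
  have h1 := padicValNat_choose_add_sigma (2 * k) k
  have h2 := sigma_three_mul_add_lt h
  rw [show 2 * k + k = 3 * k by ring, sigma_two_mul] at h1
  exact (pow_dvd_pow 2 (by omega)).trans pow_padicValNat_dvd

/-- For `k = 8 * q + 3` with `q` Fibbinary, the binomial coefficient `C(3 * k - 2, k - 3)` is odd:
no carry occurs in adding `2 * k + 1` and `k - 3`. -/
lemma odd_choose_of_eq_eight_mul_add_three {q : ℕ} (h : commonOnes (2 * q) q = 0) :
    ¬ 2 ∣ (2 * (8 * q) + 7 + 8 * q).choose (8 * q) := by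
  have h1 := padicValNat_choose_add_sigma (2 * (8 * q) + 7) (8 * q)
  have h2 := sigma_three_mul_of_commonOnes_eq_zero h
  have e : sigma (2 * (8 * q) + 7) = sigma q + 3 := by
    rw [show 2 * (8 * q) + 7 = 2 * (2 * (2 * (2 * q) + 1) + 1) + 1 by ring]
    simp only [sigma_two_mul, sigma_two_mul_add_one]
  have e' : sigma (2 * (8 * q) + 7 + 8 * q) = sigma (3 * q) + 3 := by
    rw [show 2 * (8 * q) + 7 + 8 * q = 2 * (2 * (2 * (3 * q) + 1) + 1) + 1 by ring]
    simp only [sigma_two_mul_add_one]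
  have e'' : sigma (8 * q) = sigma q := by
    rw [show 8 * q = 2 * (2 * (2 * q)) by ring]
    simp only [sigma_two_mul]
  have h3 : padicValNat 2 ((2 * (8 * q) + 7 + 8 * q).choose (8 * q)) = 0 := by omega
  rcases padicValNat.eq_zero_iff.mp h3 with h | h | h
  · omega
  · exact absurd h (Nat.choose_pos (by omega)).ne'
  · exact h

lemma commonOnes_two_mul_self_eight_mul_add_three (q : ℕ) :
    commonOnes (2 * (8 * q + 3)) (8 * q + 3) = commonOnes (2 * q) q + 1 := by
  rw [show 8 * q + 3 = 4 * (2 * q) + 3 by ring, commonOnes_two_mul_self_four_mul_add_three,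
    show 2 * (2 * q) + 1 = 4 * q + 1 by ring, commonOnes_two_mul_self_four_mul_add_one]

/-- Here `k = j + 3`, and the binomial coefficient is `C(3 * k - 2, k - 3)`. -/
lemma two_pow_dvd_choose_of_forall_ne {j : ℕ}
    (hj : ∀ q, commonOnes (2 * q) q = 0 → j ≠ 8 * q) :
    2 ^ commonOnes (2 * (j + 3)) (j + 3) ∣ (2 * j + 7 + j).choose j := by
  suffices h : sigma (2 * j + 7 + j) + commonOnes (2 * (j + 3)) (j + 3) ≤
      sigma (2 * j + 7) + sigma j by
    have h1 := padicValNat_choose_add_sigma (2 * j + 7) j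
    exact (pow_dvd_pow 2 (by omega)).trans pow_padicValNat_dvd
  obtain ⟨i, rfl | rfl⟩ := Nat.even_or_odd' j
  · obtain ⟨m, rfl | rfl⟩ := Nat.even_or_odd' i
    · -- `k = 4 * m + 3`
      rw [show 2 * (2 * m) + 3 = 4 * m + 3 by ring, commonOnes_two_mul_self_four_mul_add_three,
        show 2 * (2 * (2 * m)) + 7 + 2 * (2 * m) = 2 * (2 * (3 * m + 1) + 1) + 1 by ring,
        show 2 * (2 * (2 * m)) + 7 = 2 * (2 * (2 * m + 1) + 1) + 1 by ring]
      simp only [sigma_two_mul, sigma_two_mul_add_one]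
      obtain ⟨q, rfl | rfl⟩ := Nat.even_or_odd' m
      · have h0 : 1 ≤ commonOnes (2 * q) q := by
          by_contra h0
          exact hj q (by omega) (by ring)
        have := sigma_three_mul_add_lt h0
        rw [show 2 * (2 * q) + 1 = 4 * q + 1 by ring, commonOnes_two_mul_self_four_mul_add_one,
          show 3 * (2 * q) + 1 = 2 * (3 * q) + 1 by ring]
        simp only [sigma_two_mul, sigma_two_mul_add_one]
        omega
      · have := sigma_three_mul_add_one_add_le_of_odd (l := 2 * q + 1) ⟨q, rfl⟩
        rw [show 2 * (2 * q + 1) + 1 = 4 * q + 3 by ring,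
          commonOnes_two_mul_self_four_mul_add_three]
        omega
    · -- `k = 4 * (m + 1) + 1`: `2 * k + 1` and `k - 3` have a common one at the place of two
      have h1 := sigma_add_add_commonOnes_le (2 * (2 * (2 * m + 1)) + 7) (2 * (2 * m + 1))
      have h2 := commonOnes_add_one_le (2 * (m + 1)) m
      rw [show 2 * (2 * m + 1) + 3 = 4 * (m + 1) + 1 by ring,
        commonOnes_two_mul_self_four_mul_add_one]
      have h3 : commonOnes (2 * (2 * (2 * m + 1)) + 7) (2 * (2 * m + 1)) =
          commonOnes (2 * (m + 1)) m + 1 := by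
        rw [show 2 * (2 * (2 * m + 1)) + 7 = 2 * (2 * (2 * (m + 1)) + 1) + 1 by ring,
          commonOnes_odd_even, commonOnes_odd_odd]
      omega
  · -- `k = 2 * (i + 2)`: `2 * k + 1` and `k - 3` have a common one at the lowest place
    have h1 := sigma_add_add_commonOnes_le (2 * (2 * i + 1) + 7) (2 * i + 1)
    have h2 := commonOnes_add_two_le (2 * (i + 2)) i
    rw [show 2 * i + 1 + 3 = 2 * (i + 2) by ring, commonOnes_two_mul_self_even]
    have h3 : commonOnes (2 * (2 * i + 1) + 7) (2 * i + 1) =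
        commonOnes (2 * (i + 2)) i + 1 := by
      rw [show 2 * (2 * i + 1) + 7 = 2 * (2 * (i + 2)) + 1 by ring, commonOnes_odd_odd]
    omega

/-! ### The Stirling numbers as coefficients of powers of a 2-adic series -/

lemma isUnit_natCast_of_odd {q : ℕ} (hq : Odd q) : IsUnit (q : ℤ_[2]) := by
  rw [PadicInt.isUnit_iff]
  refine le_antisymm (PadicInt.norm_le_one _) (not_lt.mp fun h => ?_)
  have := (PadicInt.norm_int_lt_one_iff_dvd (p := 2) (q : ℤ)).mp (by simpa using h)
  have h2 : ¬ 2 ∣ q := hq.not_two_dvd_nat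
  exact h2 (by exact_mod_cast this)

lemma exists_succ_mul_eq_neg_two_pow (j : ℕ) :
    ∃ b : ℤ_[2], ((j : ℤ_[2]) + 1) * b = (-2) ^ j := by
  obtain ⟨v, q, hq, hj⟩ := Nat.exists_eq_two_pow_mul_odd (n := j + 1) (by omega)
  have hv : v ≤ j := by
    have h1 : 2 ^ v ≤ j + 1 := Nat.le_of_dvd (by omega) ⟨q, hj⟩
    have h2 : v < 2 ^ v := Nat.lt_two_pow_self
    omega
  have hd : ((j : ℤ_[2]) + 1) ∣ (-2) ^ j := by
    have h1 : (j : ℤ_[2]) + 1 = 2 ^ v * q := by exact_mod_cast congrArg (Nat.cast (R := ℤ_[2])) hj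
    rw [h1, (isUnit_natCast_of_odd hq).mul_right_dvd, neg_pow]
    exact (pow_dvd_pow 2 hv).mul_left _
  obtain ⟨b, hb⟩ := hd
  exact ⟨b, hb.symm⟩

/-- The coefficient `(-2) ^ j / (j + 1)`, a 2-adic integer, of the power series
`log (1 + 2 * X) / (2 * X)`. -/
noncomputable def logCoeff (j : ℕ) : ℤ_[2] := (exists_succ_mul_eq_neg_two_pow j).choose

lemma succ_mul_logCoeff (j : ℕ) : ((j : ℤ_[2]) + 1) * logCoeff j = (-2) ^ j :=
  (exists_succ_mul_eq_neg_two_pow j).choose_spec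

lemma two_pow_dvd_logCoeff {j m : ℕ} (h : ∀ v, 2 ^ v ∣ j + 1 → v + m ≤ j) :
    2 ^ m ∣ logCoeff j := by
  obtain ⟨v, q, hq, hj⟩ := Nat.exists_eq_two_pow_mul_odd (n := j + 1) (by omega)
  have h1 : (j : ℤ_[2]) + 1 = 2 ^ v * q := by exact_mod_cast congrArg (Nat.cast (R := ℤ_[2])) hj
  have hv := h v ⟨q, hj⟩
  have h2 := succ_mul_logCoeff j
  rw [h1, mul_assoc] at h2
  have h3 : (2 : ℤ_[2]) ^ v * 2 ^ m ∣ 2 ^ v * (q * logCoeff j) := by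
    rw [h2, neg_pow, ← pow_add]
    exact (pow_dvd_pow 2 hv).mul_left _
  have h4 := (mul_dvd_mul_iff_left (pow_ne_zero v two_ne_zero)).mp h3
  exact (isUnit_natCast_of_odd hq).dvd_mul_left.mp h4

lemma logCoeff_zero : logCoeff 0 = 1 := by simpa using succ_mul_logCoeff 0

lemma logCoeff_one : logCoeff 1 = -1 := by
  have := succ_mul_logCoeff 1
  exact mul_left_cancel₀ (two_ne_zero (α := ℤ_[2])) (by push_cast at this; linear_combination this)

lemma logCoeff_three : logCoeff 3 = -2 := by
  have := succ_mul_logCoeff 3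
  exact mul_left_cancel₀ (show (4 : ℤ_[2]) ≠ 0 by norm_num)
    (by push_cast at this; linear_combination this)

lemma lt_two_pow_of_four_le {j : ℕ} (hj : 4 ≤ j) : j + 1 < 2 ^ (j - (j + 4) / 3 + 1) := by
  induction j using Nat.strong_induction_on with
  | _ j ih =>
    by_cases h : j < 7
    · interval_cases j <;> norm_num
    · obtain ⟨i, rfl⟩ := Nat.exists_eq_add_of_le' (show 3 ≤ j by omega)
      have := ih i (by omega) (by omega)
      rw [show i + 3 - (i + 3 + 4) / 3 + 1 = (i - (i + 4) / 3 + 1) + 2 by omega, pow_add]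
      omega

lemma two_pow_dvd_logCoeff_of_ne {j : ℕ} (h0 : j ≠ 0) (h1 : j ≠ 1) (h3 : j ≠ 3) :
    2 ^ ((j + 4) / 3) ∣ logCoeff j := by
  refine two_pow_dvd_logCoeff fun v hv => ?_
  rcases (by omega : j = 2 ∨ 4 ≤ j) with rfl | hj
  · rcases Nat.eq_zero_or_pos v with rfl | hv'
    · norm_num
    · have := (dvd_pow_self 2 hv'.ne').trans hv
      omega
  · by_contra hc
    have ha : 2 ^ (j - (j + 4) / 3 + 1) ≤ 2 ^ v := Nat.pow_le_pow_right (by norm_num) (by omega)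
    have hb := Nat.le_of_dvd (by omega) hv
    have := lt_two_pow_of_four_le hj
    omega

/-- The power series `log (1 + 2 * X) / (2 * X)` over the 2-adic integers. -/
noncomputable def logSeries : ℤ_[2]⟦X⟧ := mk logCoeff

/-- The power series `(1 + 2 * X)⁻¹`, the derivative of `X * logSeries`. -/
noncomputable def geomSeries : ℤ_[2]⟦X⟧ := mk fun r => (-2) ^ r

/-- The multiplicative inverse of `logSeries`. -/
noncomputable def invLogSeries : ℤ_[2]⟦X⟧ := invOfUnit logSeries 1

/-- The part of `logSeries` in degrees at least two: what remains after removing `1 - X`. -/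
noncomputable def logTail : ℤ_[2]⟦X⟧ := logSeries - (1 - X)

lemma geomSeries_mul : geomSeries * (1 + 2 * X) = 1 := by
  ext n
  rw [mul_add, mul_one, mul_left_comm, ← mul_assoc, map_add]
  cases n with
  | zero => simp [geomSeries]
  | succ n =>
    rw [coeff_succ_mul_X, show (2 : ℤ_[2]⟦X⟧) = C 2 from (map_ofNat C 2).symm, coeff_C_mul]
    simp [geomSeries, coeff_one, pow_succ]
    ring

lemma logSeries_mul_invLogSeries : logSeries * invLogSeries = 1 :=
  mul_invOfUnit _ _ (by simp [logSeries, logCoeff_zero])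

lemma logSeries_add_X_mul_derivative :
    logSeries + X * derivative ℤ_[2] logSeries = geomSeries := by
  ext n
  rw [geomSeries, coeff_mk, ← succ_mul_logCoeff, map_add, logSeries]
  cases n with
  | zero => simp
  | succ n =>
    rw [coeff_succ_X_mul, coeff_derivative, coeff_mk]
    push_cast
    ring

/-- The residue of an exact differential vanishes: this is integration by parts in the residue of
`X ^ k * d((X * logSeries) ^ (-(n + 1)))`, written in terms of power series coefficients. -/
lemma succ_mul_coeff_invLogSeries_pow (n x : ℕ) :
    ((n : ℤ_[2]) + 1) * coeff x (invLogSeries ^ (n + 2) * geomSeries) =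
      ((n : ℤ_[2]) + 1 - x) * coeff x (invLogSeries ^ (n + 1)) := by
  have hw := logSeries_mul_invLogSeries
  have hd := congrArg (derivative ℤ_[2]) hw
  rw [Derivation.leibniz, Derivation.map_one_eq_zero, smul_eq_mul, smul_eq_mul] at hd
  have hp : derivative ℤ_[2] (invLogSeries ^ (n + 1)) =
      ((n : ℤ_[2]⟦X⟧) + 1) * invLogSeries ^ n * derivative ℤ_[2] invLogSeries := by
    rw [Derivation.leibniz_pow]
    simp [mul_assoc]
  have key : ((n : ℤ_[2]⟦X⟧) + 1) * (invLogSeries ^ (n + 2) * geomSeries) =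
      ((n : ℤ_[2]⟦X⟧) + 1) * invLogSeries ^ (n + 1) -
        X * derivative ℤ_[2] (invLogSeries ^ (n + 1)) := by
    rw [hp, ← logSeries_add_X_mul_derivative]
    linear_combination ((n : ℤ_[2]⟦X⟧) + 1) * invLogSeries ^ (n + 1) * hw +
      ((n : ℤ_[2]⟦X⟧) + 1) * invLogSeries ^ (n + 1) * X * hd -
      ((n : ℤ_[2]⟦X⟧) + 1) * X * invLogSeries ^ n * derivative ℤ_[2] invLogSeries * hw
  have hc : ((n : ℤ_[2]⟦X⟧) + 1) = C ((n : ℤ_[2]) + 1) := by simp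
  have := congrArg (coeff x) key
  rw [hc, map_sub, coeff_C_mul, coeff_C_mul] at this
  rw [this]
  cases x with
  | zero => simp
  | succ x =>
    rw [coeff_succ_X_mul, coeff_derivative]
    push_cast
    ring

/-- The Stirling number `S(k + d, k)` as a coefficient: since `(exp (2 * y) - 1) / 2` is the
compositional inverse of `X * logSeries`, this is Lagrange inversion for the exponential generating
function of the Stirling numbers. -/
lemma two_pow_mul_factorial_mul_stirlingSecond (d k : ℕ) :
    (2 : ℤ_[2]) ^ d * (k.factorial : ℤ_[2]) * (Nat.stirlingSecond (k + d) k : ℤ_[2]) =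
      ((k + d).factorial : ℤ_[2]) * coeff d (invLogSeries ^ (k + d + 1) * geomSeries) := by
  induction d generalizing k with
  | zero =>
    have h1 : constantCoeff invLogSeries = (1 : ℤ_[2]) := by simp [invLogSeries]
    have h2 : constantCoeff geomSeries = (1 : ℤ_[2]) := by
      simp [geomSeries]
    simp [Nat.stirlingSecond_self, h1, h2]
  | succ d ihd =>
    induction k with
    | zero =>
      have h := succ_mul_coeff_invLogSeries_pow d (d + 1)
      have h0 : ((d : ℤ_[2]) + 1) ≠ 0 := by exact_mod_cast Nat.succ_ne_zero d
      rw [Nat.cast_add_one, sub_self, zero_mul, mul_eq_zero, or_iff_right h0] at h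
      rw [show 0 + (d + 1) + 1 = d + 2 by ring, h]
      simp [Nat.stirlingSecond_succ_zero]
    | succ k ihk =>
      have h := succ_mul_coeff_invLogSeries_pow (k + d + 1) (d + 1)
      have hv : coeff (d + 1) (invLogSeries ^ (k + d + 2)) =
          coeff (d + 1) (invLogSeries ^ (k + d + 2) * geomSeries) +
            2 * coeff d (invLogSeries ^ (k + d + 2) * geomSeries) := by
        have e : invLogSeries ^ (k + d + 2) =
            invLogSeries ^ (k + d + 2) * geomSeries +
              C 2 * (invLogSeries ^ (k + d + 2) * geomSeries) * X := by
          rw [show (C (2 : ℤ_[2])) = 2 from map_ofNat C 2]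
          linear_combination -(invLogSeries ^ (k + d + 2)) * geomSeries_mul
        conv_lhs => rw [e, map_add, coeff_succ_mul_X, coeff_C_mul]
      have h1 := ihd (k + 1)
      rw [show k + 1 + d = k + d + 1 by ring] at h1
      rw [show k + (d + 1) = k + d + 1 by ring] at ihk
      rw [show k + 1 + (d + 1) = k + d + 1 + 1 by ring, Nat.stirlingSecond_succ_succ,
        Nat.factorial_succ (k + d + 1), Nat.factorial_succ k]
      rw [Nat.factorial_succ k] at h1
      rw [show k + d + 1 + 1 = k + d + 2 by ring] at *
      rw [show k + d + 2 + 1 = k + d + 1 + 2 by ring]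
      rw [show k + d + 1 + 1 = k + d + 2 by ring, hv] at h
      push_cast at *
      linear_combination ((k + d + 1).factorial : ℤ_[2]) * (-h) + 2 * ((k : ℤ_[2]) + 1) * h1 +
        ((k : ℤ_[2]) + 1) * ihk

/-- Division by `(2 * k)! / (2 ^ k * k!) = (2 * k - 1)‼`, an odd number. -/
lemma exists_odd_stirlingSecond_eq (k : ℕ) : ∃ q : ℕ, Odd q ∧
    (Nat.stirlingSecond (2 * k) k : ℤ_[2]) =
      q * coeff k (invLogSeries ^ (2 * k + 1) * geomSeries) := by
  have hq : ∃ q : ℕ, Odd q ∧ (2 * k).factorial = 2 ^ k * k.factorial * q := by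
    induction k with
    | zero => exact ⟨1, odd_one, by simp⟩
    | succ k ih =>
      obtain ⟨q, hq, h⟩ := ih
      refine ⟨(2 * k + 1) * q, Odd.mul ⟨k, rfl⟩ hq, ?_⟩
      rw [show 2 * (k + 1) = 2 * k + 1 + 1 by ring, Nat.factorial_succ, Nat.factorial_succ, h,
        Nat.factorial_succ]
      ring
  obtain ⟨q, hq, h⟩ := hq
  refine ⟨q, hq, ?_⟩
  have hs := two_pow_mul_factorial_mul_stirlingSecond k k
  have h' : ((2 * k).factorial : ℤ_[2]) = 2 ^ k * k.factorial * q := by exact_mod_cast h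
  rw [← two_mul, h', mul_assoc _ (q : ℤ_[2])] at hs
  refine mul_left_cancel₀ (mul_ne_zero (pow_ne_zero k two_ne_zero) ?_) hs
  exact_mod_cast k.factorial_ne_zero

/-! ### Expansion of powers of the inverse series -/

lemma pow_succ_dvd_one_sub_pow_mul_sum {R : Type*} [CommRing R] (t : R) (N K : ℕ) :
    t ^ (K + 1) ∣
      (1 - t) ^ (N + 1) * ∑ i ∈ Finset.range (K + 1), ((N + i).choose i : R) * t ^ i - 1 := by
  induction N with
  | zero =>
    have h := mul_neg_geom_sum t (K + 1)
    simp only [zero_add, Nat.choose_self, Nat.cast_one, one_mul, pow_one, h]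
    exact ⟨-1, by ring⟩
  | succ N ih =>
    have h : (1 - t) * ∑ i ∈ Finset.range (K + 1), ((N + 1 + i).choose i : R) * t ^ i =
        ∑ i ∈ Finset.range (K + 1), ((N + i).choose i : R) * t ^ i -
          ((N + 1 + K).choose K : R) * t ^ (K + 1) := by
      clear ih
      induction K with
      | zero => simp
      | succ K ih =>
        have hc : (N + 1 + (K + 1)).choose (K + 1) =
            (N + 1 + K).choose K + (N + (K + 1)).choose (K + 1) := by
          rw [show N + 1 + (K + 1) = N + 1 + K + 1 by ring, Nat.choose_succ_succ,
            show N + (K + 1) = N + 1 + K by ring]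
        rw [Finset.sum_range_succ, mul_add, ih, Finset.sum_range_succ _ (K + 1), hc]
        push_cast
        ring
    rw [pow_succ (1 - t) (N + 1), mul_assoc, h, mul_sub, sub_right_comm]
    exact dvd_sub ih ⟨(1 - t) ^ (N + 1) * ((N + 1 + K).choose K : R), by ring⟩

/-- Expansion of `logSeries ^ (-(N + 1)) = ((1 - X) + logTail) ^ (-(N + 1))` in powers of
`logTail`. -/
lemma coeff_invLogSeries_pow_mul (N k : ℕ) (f : ℤ_[2]⟦X⟧) :
    coeff k (invLogSeries ^ (N + 1) * f) =
      ∑ i ∈ Finset.range (k + 1), ∑ p ∈ Finset.HasAntidiagonal.antidiagonal k,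
        (-1) ^ i * (((N + i).choose i * (N + i + p.2).choose p.2 : ℕ) : ℤ_[2]) *
          coeff p.1 (logTail ^ i * f) := by
  set G : ℤ_[2]⟦X⟧ := mk 1 with hG
  have hG1 : G * (1 - X) = 1 := mk_one_mul_one_sub_eq_one _
  set t : ℤ_[2]⟦X⟧ := -(logTail * G) with ht
  have hWt : invLogSeries * (1 - t) = G := by
    have h := logSeries_mul_invLogSeries
    have hl : logSeries = (1 - X) + logTail := by rw [logTail]; ring
    rw [hl] at h
    rw [ht]
    linear_combination G * h - invLogSeries * hG1
  have hX : X ∣ t := by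
    rw [ht, X_dvd_iff]
    simp [logTail, logSeries, logCoeff_zero]
  have hd : X ^ (k + 1) ∣ G ^ (N + 1) *
      (∑ i ∈ Finset.range (k + 1), ((N + i).choose i : ℤ_[2]⟦X⟧) * t ^ i) * f -
        invLogSeries ^ (N + 1) * f := by
    have h := (pow_dvd_pow_of_dvd hX (k + 1)).trans (pow_succ_dvd_one_sub_pow_mul_sum t N k)
    have h' := h.mul_left (invLogSeries ^ (N + 1) * f)
    convert h' using 1
    rw [← hWt, mul_pow]
    ring
  have h0 := X_pow_dvd_iff.mp hd k (by omega)
  rw [map_sub, sub_eq_zero] at h0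
  rw [← h0, Finset.mul_sum, Finset.sum_mul, map_sum]
  refine Finset.sum_congr rfl fun i _ => ?_
  have hi : G ^ (N + 1) * (((N + i).choose i : ℤ_[2]⟦X⟧) * t ^ i) * f =
      C ((-1) ^ i * ((N + i).choose i : ℤ_[2])) * ((logTail ^ i * f) * G ^ (N + i + 1)) := by
    rw [ht, neg_pow, mul_pow]
    simp only [map_mul, map_pow, map_neg, map_one, map_natCast]
    ring
  rw [hi, coeff_C_mul, coeff_mul, Finset.mul_sum]
  refine Finset.sum_congr rfl fun p _ => ?_
  rw [hG, mk_one_pow_eq_mk_choose_add, coeff_mk, Nat.choose_symm_add]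
  push_cast
  ring

/-! ### A filtration of power series by the slope of their valuations -/

/-- The power series whose coefficient in degree `x` is divisible by `2 ^ ⌈(x + s) / 3⌉`. These form
a filtration in `s`, compatible with multiplication. -/
def SlopeThird (s : ℕ) (f : ℤ_[2]⟦X⟧) : Prop :=
  ∀ x, 2 ^ ((x + s + 2) / 3) ∣ coeff x f

lemma SlopeThird.mul {s t : ℕ} {f g : ℤ_[2]⟦X⟧} (hf : SlopeThird s f) (hg : SlopeThird t g) :
    SlopeThird (s + t) (f * g) := by
  intro x
  rw [coeff_mul]
  refine Finset.dvd_sum fun p hp => ?_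
  rw [Finset.HasAntidiagonal.mem_antidiagonal] at hp
  refine (pow_dvd_pow 2 ?_).trans ((pow_add (2 : ℤ_[2]) _ _).dvd.trans
    (mul_dvd_mul (hf p.1) (hg p.2)))
  omega

lemma SlopeThird.add {s : ℕ} {f g : ℤ_[2]⟦X⟧} (hf : SlopeThird s f) (hg : SlopeThird s g) :
    SlopeThird s (f + g) := fun x => by
  rw [map_add]
  exact dvd_add (hf x) (hg x)

lemma SlopeThird.mono {s t : ℕ} (hst : s ≤ t) {f : ℤ_[2]⟦X⟧} (hf : SlopeThird t f) :
    SlopeThird s f :=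
  fun x => (pow_dvd_pow 2 (Nat.div_le_div_right (by omega))).trans (hf x)

lemma slopeThird_one : SlopeThird 0 1 := by
  intro x
  rw [coeff_one]
  split_ifs with h
  · simp [h]
  · exact dvd_zero _

lemma SlopeThird.pow {f : ℤ_[2]⟦X⟧} (hf : SlopeThird 0 f) (i : ℕ) : SlopeThird 0 (f ^ i) := by
  induction i with
  | zero => simpa using slopeThird_one
  | succ i ih => simpa [pow_succ] using ih.mul hf

lemma slopeThird_geomSeries_sub_one : SlopeThird 2 (geomSeries - 1) := by
  intro x
  rw [map_sub, geomSeries, coeff_mk, coeff_one]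
  split_ifs with h
  · simp [h]
  · rw [sub_zero, neg_pow]
    exact (pow_dvd_pow 2 (by omega)).mul_left _

lemma coeff_logTail_sub (x : ℕ) :
    coeff x (logTail - C (-2) * X ^ 3) = if x = 0 ∨ x = 1 ∨ x = 3 then 0 else logCoeff x := by
  rw [logTail, map_sub, map_sub, map_sub, coeff_C_mul, coeff_X_pow, coeff_one, coeff_X, logSeries,
    coeff_mk]
  rcases (by omega : x = 0 ∨ x = 1 ∨ x = 3 ∨ (x ≠ 0 ∧ x ≠ 1 ∧ x ≠ 3)) with
    rfl | rfl | rfl | ⟨h0, h1, h3⟩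
  · simp [logCoeff_zero]
  · simp [logCoeff_one]
  · simp [logCoeff_three]
  · simp [h0, h1, h3]

lemma slopeThird_logTail_sub : SlopeThird 2 (logTail - C (-2) * X ^ 3) := by
  intro x
  rw [coeff_logTail_sub]
  split_ifs with h
  · exact dvd_zero _
  · push Not at h
    exact two_pow_dvd_logCoeff_of_ne h.1 h.2.1 h.2.2

lemma slopeThird_C_mul_X_pow_three : SlopeThird 0 (C (-2 : ℤ_[2]) * X ^ 3) := by
  intro x
  rw [coeff_C_mul, coeff_X_pow]
  split_ifs with h
  · subst h
    norm_num
  · simp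

/-- Up to terms of higher slope, only the monomial `-2 * X ^ 3` of `logTail` matters. -/
lemma slopeThird_logTail_pow_mul_sub (i : ℕ) :
    SlopeThird 2 (logTail ^ i * geomSeries - (C (-2) * X ^ 3) ^ i) := by
  have hT : SlopeThird 0 logTail := by
    simpa using (slopeThird_logTail_sub.mono (Nat.zero_le 2)).add slopeThird_C_mul_X_pow_three
  have hp : SlopeThird 2 (logTail ^ i - (C (-2) * X ^ 3) ^ i) := by
    induction i with
    | zero => intro x; simp
    | succ i ih =>
      have := ((hT.pow i).mul slopeThird_logTail_sub).add (ih.mul slopeThird_C_mul_X_pow_three)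
      convert this using 1
      ring
  convert ((hT.pow i).mul slopeThird_geomSeries_sub_one).add hp using 1
  ring

/-! ### The congruence modulo one more power of two than the estimate -/

/-- The number `C(N + i, i) * C(N + i + y, y)` is a trinomial coefficient, hence a multiple of
`C(N + y, y)`. -/
lemma choose_mul_choose_eq (N i y : ℕ) :
    (N + i).choose i * (N + i + y).choose y = (N + y).choose y * (N + y + i).choose i := by
  have h1 := Nat.add_choose_mul_factorial_mul_factorial N i
  have h2 := Nat.add_choose_mul_factorial_mul_factorial (N + i) y
  have h3 := Nat.add_choose_mul_factorial_mul_factorial N y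
  have h4 := Nat.add_choose_mul_factorial_mul_factorial (N + y) i
  rw [show N + y + i = N + i + y by ring] at h4 ⊢
  have hpos : 0 < N.factorial * i.factorial * y.factorial := by positivity
  refine Nat.eq_of_mul_eq_mul_right hpos ?_
  calc _ = (N + i + y).choose y * ((N + i).choose i * N.factorial * i.factorial) *
        y.factorial := by ring
    _ = (N + i + y).choose i * ((N + y).choose y * N.factorial * y.factorial) *
        i.factorial := by rw [h1, h2, h3, h4]
    _ = _ := by ring

lemma two_pow_commonOnes_dvd_choose_mul_choose (N i y : ℕ) :
    2 ^ commonOnes N y ∣ (N + i).choose i * (N + i + y).choose y := by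
  rw [choose_mul_choose_eq]
  exact (two_pow_commonOnes_dvd_choose N y).mul_right _

/-- A multiple of `2 ^ ⌈(x + 2) / 3⌉` makes up for the loss of common ones in lowering `k` to
`k - x`, with a factor two to spare. -/
lemma commonOnes_two_mul_add_lt (x y : ℕ) :
    commonOnes (2 * (x + y)) (x + y) + 1 ≤ commonOnes (2 * (x + y)) y + (x + 4) / 3 := by
  rcases eq_or_ne x 1 with rfl | hx
  · have := commonOnes_two_mul_succ_le y
    rw [add_comm 1 y]
    omega
  · have := commonOnes_even_add_le (x + y) y x
    rw [add_comm y x] at this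
    omega

/-- The powers `(-2 * X ^ 3) ^ i` contribute to the leading order only for `i ≤ 1`. For `i = 2` and
`k = 4 * m + 3` two common ones may be lost, and the spare factor two is found in
`C(3 * k - 4, 2)`. -/
lemma two_pow_succ_dvd_two_pow_mul_choose_mul_choose {i y k : ℕ} (hi : 2 ≤ i) (hk : 3 * i + y = k) :
    2 ^ (commonOnes (2 * k) k + 1) ∣
      2 ^ i * ((2 * k + i).choose i * (2 * k + i + y).choose y) := by
  have of_le (h : commonOnes (2 * k) k + 1 ≤ i + commonOnes (2 * k) y) :
      2 ^ (commonOnes (2 * k) k + 1) ∣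
        2 ^ i * ((2 * k + i).choose i * (2 * k + i + y).choose y) :=
    (pow_dvd_pow 2 h).trans ((pow_add 2 _ _).dvd.trans
      (mul_dvd_mul_left _ (two_pow_commonOnes_dvd_choose_mul_choose (2 * k) i y)))
  rcases (by omega : i = 2 ∨ i = 3 ∨ 4 ≤ i) with rfl | rfl | hi4
  · obtain ⟨l, hl | hl⟩ := Nat.even_or_odd' k
    · obtain ⟨z, rfl⟩ : ∃ z, y = 2 * z := ⟨l - 3, by omega⟩
      obtain rfl : l = z + 3 := by omega
      refine of_le ?_
      have := commonOnes_even_add_three_le (z + 3) z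
      rw [hl, commonOnes_two_mul_self_even, commonOnes_even_even]
      omega
    obtain ⟨m, rfl | rfl⟩ := Nat.even_or_odd' l
    · obtain ⟨z, rfl⟩ : ∃ z, m = z + 2 := ⟨m - 2, by omega⟩
      obtain rfl : y = 2 * (2 * z + 1) + 1 := by omega
      refine of_le ?_
      have := commonOnes_add_two_le (2 * (z + 2)) z
      rw [hl, show 2 * (2 * (z + 2)) + 1 = 4 * (z + 2) + 1 by ring,
        commonOnes_two_mul_self_four_mul_add_one,
        show 4 * (z + 2) + 1 = 2 * (2 * (z + 2)) + 1 by ring, commonOnes_even_odd,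
        commonOnes_odd_odd]
      omega
    · obtain ⟨z, rfl⟩ : ∃ z, m = z + 1 := ⟨m - 1, by omega⟩
      obtain rfl : y = 2 * (2 * z) + 1 := by omega
      have h1 : commonOnes (2 * k) k ≤ commonOnes (2 * k) (2 * (2 * z) + 1) + 2 := by
        have := commonOnes_add_one_le (2 * (z + 1) + 1) z
        rw [hl, show 2 * (2 * (z + 1) + 1) + 1 = 4 * (z + 1) + 3 by ring,
          commonOnes_two_mul_self_four_mul_add_three,
          show 4 * (z + 1) + 3 = 2 * (2 * (z + 1) + 1) + 1 by ring, commonOnes_even_odd,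
          commonOnes_even_odd, commonOnes_odd_even]
        omega
      have h2 : 2 ∣ (2 * k + (2 * (2 * z) + 1) + 2).choose 2 := by
        rw [show 2 * k + (2 * (2 * z) + 1) + 2 = 12 * z + 17 by omega, Nat.choose_two_right,
          show (12 * z + 17) * (12 * z + 17 - 1) = 2 * (2 * ((12 * z + 17) * (3 * z + 4))) by
            rw [show 12 * z + 17 - 1 = 4 * (3 * z + 4) by omega]; ring,
          Nat.mul_div_cancel_left _ (by norm_num)]
        exact dvd_mul_right _ _
      rw [choose_mul_choose_eq]
      have h3 := mul_dvd_mul (dvd_refl (2 ^ 2))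
        (mul_dvd_mul (two_pow_commonOnes_dvd_choose (2 * k) (2 * (2 * z) + 1)) h2)
      rw [← pow_succ, ← pow_add] at h3
      exact (pow_dvd_pow 2 (by omega)).trans h3
  · refine of_le ?_
    have h1 := commonOnes_add_eight_le (2 * k) y
    have h2 := commonOnes_add_one_le (2 * k) (y + 8)
    rw [show y + 8 + 1 = k by omega] at h2
    omega
  · refine of_le ?_
    have := commonOnes_even_add_le k y (3 * i)
    rw [show y + 3 * i = k by omega] at this
    omega

/-- The 2-adic integer `c` with `S(2 * k, k) = (2 * k - 1)‼ * c`, at `k = j + 3`: all summands of its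
expansion but two vanish modulo `2 ^ (P + 1)`, where `P` is the number of common ones of `2 * k` and
`k`. -/
lemma two_pow_succ_dvd_coeff_sub (j : ℕ) :
    (2 : ℤ_[2]) ^ (commonOnes (2 * (j + 3)) (j + 3) + 1) ∣
      coeff (j + 3) (invLogSeries ^ (2 * (j + 3) + 1) * geomSeries) -
        (((3 * (j + 3)).choose (j + 3) : ℕ) +
          2 * (((2 * (j + 3) + 1) * (2 * j + 7 + j).choose j : ℕ) : ℤ_[2])) := by
  set k := j + 3 with hk
  set S := Finset.range (k + 1) ×ˢ Finset.HasAntidiagonal.antidiagonal k with hS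
  set A : ℤ_[2] := (((3 * k).choose k : ℕ) : ℤ_[2]) with hA
  set B : ℤ_[2] := 2 * (((2 * k + 1) * (2 * j + 7 + j).choose j : ℕ) : ℤ_[2]) with hB
  have hAB : A + B = ∑ q ∈ S, ((if q = (0, (0, k)) then A else 0) +
      if q = (1, (3, j)) then B else 0) := by
    rw [Finset.sum_add_distrib, Finset.sum_ite_eq' S, Finset.sum_ite_eq' S, if_pos, if_pos]
    · simp [hS, Finset.HasAntidiagonal.mem_antidiagonal, hk, add_comm]
    · simp [hS, Finset.HasAntidiagonal.mem_antidiagonal]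
  rw [coeff_invLogSeries_pow_mul, ← Finset.sum_product', hAB, ← Finset.sum_sub_distrib]
  refine Finset.dvd_sum ?_
  rintro ⟨i, x, y⟩ hq
  have hxy : x + y = k := by
    simpa [hS, Finset.HasAntidiagonal.mem_antidiagonal] using (Finset.mem_product.mp hq).2
  set M := (2 * k + i).choose i * (2 * k + i + y).choose y with hM
  have herr : (2 : ℤ_[2]) ^ (commonOnes (2 * k) k + 1) ∣ (-1) ^ i * (M : ℤ_[2]) *
      coeff x (logTail ^ i * geomSeries - (C (-2) * X ^ 3) ^ i) := by
    have h1 : (2 : ℤ_[2]) ^ commonOnes (2 * k) y ∣ (M : ℤ_[2]) := by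
      exact_mod_cast Nat.cast_dvd_cast (α := ℤ_[2])
        (two_pow_commonOnes_dvd_choose_mul_choose (2 * k) i y)
    have h2 := slopeThird_logTail_pow_mul_sub i x
    have h3 := commonOnes_two_mul_add_lt x y
    rw [hxy] at h3
    exact (pow_dvd_pow 2 h3).trans ((pow_add (2 : ℤ_[2]) _ _).dvd.trans
      (mul_dvd_mul (h1.mul_left _) h2))
  have hmain : coeff x ((C (-2 : ℤ_[2]) * X ^ 3) ^ i) = if x = 3 * i then (-2) ^ i else 0 := by
    rw [mul_pow, ← map_pow, ← pow_mul, coeff_C_mul, coeff_X_pow]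
    split_ifs <;> simp
  suffices h : (2 : ℤ_[2]) ^ (commonOnes (2 * k) k + 1) ∣ (-1) ^ i * (M : ℤ_[2]) *
      (if x = 3 * i then (-2) ^ i else 0) -
        ((if (i, x, y) = (0, (0, k)) then A else 0) + if (i, x, y) = (1, (3, j)) then B else 0) by
    convert dvd_add herr h using 1
    rw [map_sub, hmain]
    ring
  by_cases hx : x = 3 * i
  · rcases (by omega : i = 0 ∨ i = 1 ∨ 2 ≤ i) with rfl | rfl | hi
    · obtain rfl : x = 0 := by omega
      obtain rfl : y = k := by omega
      have : M = (3 * k).choose k := by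
        rw [hM]
        simp only [Nat.choose_zero_right, one_mul, add_zero]
        congr 1
        ring
      simp [hA, this]
    · obtain rfl : x = 3 := by omega
      obtain rfl : y = j := by omega
      have : M = (2 * k + 1) * (2 * y + 7 + y).choose y := by
        rw [hM, Nat.choose_one_right]
        congr 2
      simp [hB, ← this]
      ring_nf
      simp
    · have h1 := two_pow_succ_dvd_two_pow_mul_choose_mul_choose hi (y := y) (k := k) (by omega)
      have h2 : (2 : ℤ_[2]) ^ (commonOnes (2 * k) k + 1) ∣ 2 ^ i * (M : ℤ_[2]) := by
        exact_mod_cast Nat.cast_dvd_cast (α := ℤ_[2]) h1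
      have e1 : (i, x, y) ≠ (0, (0, k)) := fun h => by
        have := congrArg Prod.fst h
        simp only at this
        omega
      have e2 : (i, x, y) ≠ (1, (3, j)) := fun h => by
        have := congrArg Prod.fst h
        simp only at this
        omega
      rw [if_pos hx, if_neg e1, if_neg e2, add_zero, sub_zero, neg_pow (2 : ℤ_[2])]
      convert h2.mul_left ((-1) ^ i * (-1) ^ i) using 1
      ring
  · have e1 : (i, x, y) ≠ (0, (0, k)) := fun h => by
      simp only [Prod.mk.injEq] at h
      omega
    have e2 : (i, x, y) ≠ (1, (3, j)) := fun h => by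
      simp only [Prod.mk.injEq] at h
      omega
    rw [if_neg hx, if_neg e1, if_neg e2]
    simp

/-- The congruence for `S(2 * k, k)` at `k = j + 3`, up to an odd factor, between natural numbers. -/
lemma exists_odd_stirlingSecond_modEq (j : ℕ) : ∃ q : ℕ, Odd q ∧
    Nat.stirlingSecond (2 * (j + 3)) (j + 3) ≡
      q * ((3 * (j + 3)).choose (j + 3) +
        2 * ((2 * (j + 3) + 1) * (2 * j + 7 + j).choose j))
      [MOD 2 ^ (commonOnes (2 * (j + 3)) (j + 3) + 1)] := by
  obtain ⟨q, hq, h⟩ := exists_odd_stirlingSecond_eq (j + 3)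
  refine ⟨q, hq, ?_⟩
  have hd := (two_pow_succ_dvd_coeff_sub j).mul_left (q : ℤ_[2])
  rw [mul_sub, ← h] at hd
  refine (Nat.modEq_iff_dvd.mpr ?_).symm
  have := (PadicInt.pow_p_dvd_int_iff (p := 2) (commonOnes (2 * (j + 3)) (j + 3) + 1)
    ((Nat.stirlingSecond (2 * (j + 3)) (j + 3) : ℕ) -
      (q * ((3 * (j + 3)).choose (j + 3) +
        2 * ((2 * (j + 3) + 1) * (2 * j + 7 + j).choose j) : ℕ) : ℕ))).mp
      (by push_cast at hd ⊢; exact hd)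
  exact_mod_cast this

/-! ### The valuation of the central Stirling numbers -/

lemma two_pow_commonOnes_dvd_two_mul_choose (j : ℕ) :
    2 ^ commonOnes (2 * (j + 3)) (j + 3) ∣ 2 * (2 * j + 7 + j).choose j := by
  by_cases hj : ∃ q, commonOnes (2 * q) q = 0 ∧ j = 8 * q
  · obtain ⟨q, hq, rfl⟩ := hj
    rw [commonOnes_two_mul_self_eight_mul_add_three, hq]
    exact dvd_mul_right _ _
  · push Not at hj
    exact (two_pow_dvd_choose_of_forall_ne hj).mul_left 2

lemma two_pow_commonOnes_dvd_stirlingSecond (j : ℕ) :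
    2 ^ commonOnes (2 * (j + 3)) (j + 3) ∣ Nat.stirlingSecond (2 * (j + 3)) (j + 3) := by
  obtain ⟨q, -, h⟩ := exists_odd_stirlingSecond_modEq j
  refine ((h.of_dvd (pow_dvd_pow 2 (Nat.le_succ _))).dvd_iff dvd_rfl).mpr
    (Dvd.dvd.mul_left (dvd_add ?_ ?_) q)
  · have := two_pow_commonOnes_dvd_choose (2 * (j + 3)) (j + 3)
    rwa [show 2 * (j + 3) + (j + 3) = 3 * (j + 3) by ring] at this
  · rw [mul_left_comm]
    exact (two_pow_commonOnes_dvd_two_mul_choose j).mul_left _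

lemma not_two_pow_succ_dvd_stirlingSecond_iff (j : ℕ) :
    ¬ 2 ^ (commonOnes (2 * (j + 3)) (j + 3) + 1) ∣ Nat.stirlingSecond (2 * (j + 3)) (j + 3) ↔
      commonOnes (2 * (j + 3)) (j + 3) = 0 ∨ ∃ q, commonOnes (2 * q) q = 0 ∧ j = 8 * q := by
  obtain ⟨q, hq, h⟩ := exists_odd_stirlingSecond_modEq j
  rw [h.dvd_iff dvd_rfl, (Nat.Coprime.pow_left _ (Nat.coprime_two_left.mpr hq)).dvd_mul_left]
  rcases Nat.eq_zero_or_pos (commonOnes (2 * (j + 3)) (j + 3)) with h0 | hpos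
  · have := odd_choose_three_mul h0
    simp only [h0, true_or, iff_true, zero_add, pow_one]
    omega
  rw [Nat.dvd_add_right (two_pow_succ_dvd_choose_three_mul hpos), mul_left_comm,
    (Nat.Coprime.pow_left _ (Nat.coprime_two_left.mpr ⟨j + 3, rfl⟩)).dvd_mul_left, pow_succ',
    Nat.mul_dvd_mul_iff_left two_pos]
  constructor
  · intro h1
    right
    by_contra hj
    push Not at hj
    exact h1 (two_pow_dvd_choose_of_forall_ne hj)
  · rintro (h0 | ⟨r, hr, rfl⟩)
    · omega
    · rw [commonOnes_two_mul_self_eight_mul_add_three, hr, zero_add, pow_one]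
      exact odd_choose_of_eq_eight_mul_add_three hr

lemma stirlingSecond_succ_add_ne_zero (k d : ℕ) : Nat.stirlingSecond (k + 1 + d) (k + 1) ≠ 0 := by
  induction d with
  | zero => simp [Nat.stirlingSecond_self]
  | succ d ih =>
    rw [show k + 1 + (d + 1) = k + 1 + d + 1 by ring, Nat.stirlingSecond_succ_succ]
    positivity

lemma stirlingSecond_two_mul_ne_zero (k : ℕ) : Nat.stirlingSecond (2 * k) k ≠ 0 := by
  rcases k with - | k
  · simp
  · rw [two_mul]
    exact stirlingSecond_succ_add_ne_zero k (k + 1)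

lemma nuS_two_mul_eq_zero_of_lt_three {k : ℕ} (hk : k < 3) : nuS (2 * k) k = 0 := by
  rw [nuS, padicValNat.eq_zero_iff]
  right
  right
  interval_cases k <;> decide

lemma commonOnes_le_nuS (k : ℕ) : commonOnes (2 * k) k ≤ nuS (2 * k) k := by
  rcases lt_or_ge k 3 with hk | hk
  · have : commonOnes (2 * k) k = 0 := by interval_cases k <;> decide +kernel
    omega
  · obtain ⟨j, rfl⟩ := Nat.exists_eq_add_of_le' hk
    exact (padicValNat_dvd_iff_le (stirlingSecond_two_mul_ne_zero _)).mp
      (two_pow_commonOnes_dvd_stirlingSecond j)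

lemma nuS_eq_commonOnes_iff (k : ℕ) : nuS (2 * k) k = commonOnes (2 * k) k ↔
    commonOnes (2 * k) k = 0 ∨ ∃ q, commonOnes (2 * q) q = 0 ∧ k = 3 + 8 * q := by
  have hle := commonOnes_le_nuS k
  rcases lt_or_ge k 3 with hk | hk
  · have := nuS_two_mul_eq_zero_of_lt_three hk
    exact ⟨fun _ => Or.inl (by omega), fun _ => by omega⟩
  · obtain ⟨j, rfl⟩ := Nat.exists_eq_add_of_le' hk
    have h := not_two_pow_succ_dvd_stirlingSecond_iff j
    rw [padicValNat_dvd_iff_le (stirlingSecond_two_mul_ne_zero _)] at h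
    change ¬ _ ≤ nuS (2 * (j + 3)) (j + 3) ↔ _ at h
    rw [show (nuS (2 * (j + 3)) (j + 3) = commonOnes (2 * (j + 3)) (j + 3) ↔
      ¬ commonOnes (2 * (j + 3)) (j + 3) + 1 ≤ nuS (2 * (j + 3)) (j + 3)) by omega, h]
    simp only [add_comm j 3, Nat.add_left_cancel_iff]

/-! ### Digit sets and counts of common ones -/

lemma mem_twoPowers {n m : ℕ} : m ∈ twoPowers n ↔ ∃ i, n.testBit i = true ∧ 2 ^ i = m := by
  simp [twoPowers]

lemma card_twoPowers (n : ℕ) : (twoPowers n).card = sigma n := by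
  rw [twoPowers, Finset.card_image_of_injective _ (Nat.pow_right_injective le_rfl),
    List.toFinset_card_of_nodup Nat.bitIndices_nodup]
  induction n using Nat.strong_induction_on with
  | _ n ih =>
    rcases Nat.eq_zero_or_pos n with rfl | hn
    · simp [sigma_zero]
    obtain ⟨m, rfl | rfl⟩ := Nat.even_or_odd' n
    · rw [Nat.bitIndices_two_mul, List.length_map, sigma_two_mul, ih m (by omega)]
    · rw [Nat.bitIndices_two_mul_add_one, List.length_cons, List.length_map,
        sigma_two_mul_add_one, ih m (by omega)]

lemma card_twoPowers_inter (n m : ℕ) :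
    (twoPowers n ∩ twoPowers m).card = commonOnes n m := by
  rw [commonOnes, ← card_twoPowers]
  congr 1
  ext x
  simp only [Finset.mem_inter, mem_twoPowers, Nat.testBit_and, Bool.and_eq_true]
  constructor
  · rintro ⟨⟨i, hi, rfl⟩, l, hl, h⟩
    obtain rfl := Nat.pow_right_injective le_rfl h
    exact ⟨l, ⟨hi, hl⟩, rfl⟩
  · rintro ⟨i, ⟨h1, h2⟩, rfl⟩
    exact ⟨⟨i, h1, rfl⟩, i, h2, rfl⟩

lemma testBit_two_mul_succ (k i : ℕ) : (2 * k).testBit (i + 1) = k.testBit i := by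
  rw [Nat.testBit_succ, Nat.mul_div_cancel_left _ two_pos]

lemma consecutiveOnePairs_eq_commonOnes (k : ℕ) :
    consecutiveOnePairs k = commonOnes (2 * k) k := by
  rw [← card_twoPowers_inter, consecutiveOnePairs]
  refine Finset.card_bij (fun i _ => 2 ^ (i + 1)) ?_ ?_ ?_
  · intro i hi
    have h := (Finset.mem_filter.mp hi).2
    exact Finset.mem_inter.mpr ⟨mem_twoPowers.mpr ⟨i + 1, by rw [testBit_two_mul_succ, h.1], rfl⟩,
      mem_twoPowers.mpr ⟨i + 1, h.2, rfl⟩⟩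
  · intro i _ l _ h
    have := Nat.pow_right_injective le_rfl h
    omega
  · intro x hx
    obtain ⟨h1, h2⟩ := Finset.mem_inter.mp hx
    obtain ⟨i, hi, rfl⟩ := mem_twoPowers.mp h1
    obtain ⟨l, hl, h⟩ := mem_twoPowers.mp h2
    obtain rfl := Nat.pow_right_injective le_rfl h
    rcases l with - | l
    · simp at hi
    rw [testBit_two_mul_succ] at hi
    have hlt : l < k := Nat.lt_two_pow_self.trans_le (Nat.ge_two_pow_of_testBit hi)
    exact ⟨l, Finset.mem_filter.mpr ⟨Finset.mem_range.mpr hlt, hi, hl⟩, rfl⟩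

lemma fibbinary_iff (k : ℕ) : Fibbinary k ↔ commonOnes (2 * k) k = 0 := by
  rw [← consecutiveOnePairs_eq_commonOnes, consecutiveOnePairs, Finset.card_eq_zero,
    Finset.filter_eq_empty_iff]
  refine ⟨fun h i _ => h i, fun h i hi => h (Finset.mem_range.mpr ?_) hi⟩
  exact Nat.lt_two_pow_self.trans_le (Nat.ge_two_pow_of_testBit hi.1)

lemma almostMinZeroEst_two_mul (k : ℕ) :
    almostMinZeroEst (2 * k) k = (commonOnes (2 * k) k : ℤ) := by
  rw [almostMinZeroEst, show 2 * k - k = k by omega, card_twoPowers_inter, sigma_two_mul, sub_self,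
    zero_add]

lemma isAMZC_two_mul_iff (k : ℕ) :
    IsAMZC (2 * k) k ↔ nuS (2 * k) k = commonOnes (2 * k) k ∧ nuS (2 * k) k ≠ 0 := by
  simp [IsAMZC, IsMZC, almostMinZeroEst_two_mul, minZeroEst, sigma_two_mul,
    stirlingSecond_two_mul_ne_zero]

end CentralStirling

theorem corollary3p2 (k : ℕ) :
    (CentralStirling.almostMinZeroEst (2 * k) k = (CentralStirling.consecutiveOnePairs k : ℤ) ∧
      CentralStirling.consecutiveOnePairs k ≤ CentralStirling.nuS (2 * k) k) ∧
    (CentralStirling.nuS (2 * k) k = 1 ↔ CentralStirling.IsAMZC (2 * k) k) ∧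
    (CentralStirling.IsAMZC (2 * k) k ↔
      ∃ k' : ℕ, k = 3 + 8 * k' ∧ CentralStirling.Fibbinary k') := by
  open CentralStirling in
  have hle := commonOnes_le_nuS k
  have hiff := nuS_eq_commonOnes_iff k
  have hone : (∃ q, commonOnes (2 * q) q = 0 ∧ k = 3 + 8 * q) → commonOnes (2 * k) k = 1 := by
    rintro ⟨q, hq, rfl⟩
    rw [add_comm 3, commonOnes_two_mul_self_eight_mul_add_three, hq]
  have hex : (∃ k' : ℕ, k = 3 + 8 * k' ∧ Fibbinary k') ↔
      ∃ q, commonOnes (2 * q) q = 0 ∧ k = 3 + 8 * q :=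
    exists_congr fun q => by rw [fibbinary_iff, and_comm]
  rw [consecutiveOnePairs_eq_commonOnes, isAMZC_two_mul_iff, hex]
  refine ⟨⟨almostMinZeroEst_two_mul k, hle⟩, ?_, ?_⟩
  · constructor
    · intro h
      refine ⟨?_, by omega⟩
      -- an estimate of zero would be sharp, so the valuation would be zero
      by_contra hne
      exact hne (hiff.mpr (Or.inl (by omega)))
    · rintro ⟨h1, h2⟩
      rcases hiff.mp h1 with h | h
      · omega
      · rw [h1, hone h]
  · constructor
    · rintro ⟨h1, h2⟩
      exact (hiff.mp h1).resolve_left (by omega)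
    · intro h
      have h1 := hiff.mpr (Or.inr h)
      exact ⟨h1, by rw [h1, hone h]; exact one_ne_zero⟩
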